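/- Let $N\ge 1$ be an integer and let $u\in\mathbb C$ with $u\neq 0$ and $\operatorname{Re}u<1$. For the Laguerre ensemble, write $$\langle F\rangle=\frac1{\mathcal Z}\int_{[0,\infty)^N}F(\lambda)\,e^{-N\sum_{i=1}^N\lambda_i}\,\Delta(\lambda)^2\,d\lambda_1\cdots d\lambda_N,\qquad \Delta(\lambda)=\prod_{i<j}(\lambda_i-\lambda_j),$$ where $\mathcal Z$ is the normalization constant with $\langle 1\rangle=1$, and $\mathrm{tr}\,e^{cH}=\sum_{i=1}^N e^{c\lambda_i}$. Then $0<\mathcal Z<\infty$, the integral defining $\langle\mathrm{tr}\,e^{NuH}\rangle$ converges absolutely, and $$\bigl\langle \mathrm{tr}\, e^{NuH}\bigr\rangle=\frac1u\,\frac1{2\pi i}\oint_{C_0}\frac{(1-z)^N}{(1-z-u)^N}\,\frac{(z+u)^N}{z^N}\,dz=\frac1u\,\frac1{2\pi i}\oint_{C_0}\Bigl(1+\frac1{z+u-1}\Bigr)^N\Bigl(1-\frac1z\Bigr)^N dz=\frac1u f_{N,N}(u).$$ Here $C_0$ is any piecewise $C^1$ closed curve in $\mathbb C\setminus\{0,1-u\}$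 of finite length with winding number $1$ about $0$ and winding number $0$ about $1-u$, and, for integers $A,B\ge0$, $f_{A,B}(u)=\frac1{2\pi i}\oint_{|z|=|1-u|/2}\bigl(1+\frac1{z+u-1}\bigr)^A\bigl(1-\frac1z\bigr)^B dz$, the circle being taken counterclockwise. -/

import Mathlib

open MeasureTheory

noncomputable section

namespace Laguerre

/-- The Vandermonde product `Δ(lam) = ∏_{i<j} (lam_i - lam_j)`. -/
def vandermonde {N : ℕ} (lam : Fin N → ℝ) : ℝ :=
  ∏ i : Fin N, ∏ j ∈ Finset.Ioi i, (lam i - lam j)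

/-- The unnormalised joint eigenvalue density `e^{-N ∑ lam_i} Δ(lam)²`. -/
def weight (N : ℕ) (lam : Fin N → ℝ) : ℝ :=
  Real.exp (-(N : ℝ) * ∑ i, lam i) * vandermonde lam ^ 2

/-- The domain of integration `[0, ∞)^N`. -/
def orthant (N : ℕ) : Set (Fin N → ℝ) := {lam | ∀ i, 0 ≤ lam i}

/-- The normalisation constant `Z` (for which the mean of `1` is `1`). -/
def partitionFunction (N : ℕ) : ℝ := ∫ lam in orthant N, weight N lam

/-- The mean `⟨F⟩` of an eigenvalue statistic `F` over the Laguerre ensemble of size `N`. -/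
def mean (N : ℕ) (F : (Fin N → ℝ) → ℂ) : ℂ :=
  ((partitionFunction N : ℝ) : ℂ)⁻¹ * ∫ lam in orthant N, (weight N lam : ℂ) * F lam

/-- `tr e^{cH} = ∑_i e^{c lam_i}`, as a function of the eigenvalues `lam_i` of `H`. -/
def traceExp {N : ℕ} (c : ℂ) (lam : Fin N → ℝ) : ℂ :=
  ∑ i, Complex.exp (c * (lam i : ℂ))

/-- The contour integral `∮_γ g(z) dz` along a closed curve. -/
def contourIntegral {a : ℂ} (γ : Path a a) (g : ℂ → ℂ) : ℂ :=
  curveIntegral (fun z : ℂ => ContinuousLinearMap.toSpanSingleton ℂ (g z)) γ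

/-- The winding number of a closed curve about a point `w` off the curve. -/
def windingNumber {a : ℂ} (γ : Path a a) (w : ℂ) : ℂ :=
  (2 * Real.pi * Complex.I)⁻¹ * contourIntegral γ (fun z => (z - w)⁻¹)

/-- The curve is `C¹` away from finitely many parameters and has finite length. -/
def IsPiecewiseC1 {a : ℂ} (γ : Path a a) : Prop :=
  (∃ S : Finset ℝ, ∀ t ∈ Set.Ioo (0 : ℝ) 1, t ∉ S → ContDiffAt ℝ 1 γ.extend t) ∧
    IntervalIntegrable (deriv γ.extend) volume 0 1

/-- An admissible contour `C₀` for the parameter `u`: a piecewise `C¹` closed curve that goes once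
counterclockwise round the pole `z = 0` and does not encircle the pole `z = 1 - u`. -/
structure IsContour (u : ℂ) {a : ℂ} (γ : Path a a) : Prop where
  piecewiseC1 : IsPiecewiseC1 γ
  avoids_zero : ∀ t, γ t ≠ 0
  avoids_pole : ∀ t, γ t ≠ 1 - u
  winding_zero : windingNumber γ 0 = 1
  winding_pole : windingNumber γ (1 - u) = 0

/-- `f_{A,B}(u) = (1 / 2πi) ∮ (1 + 1/(z+u-1))^A (1 - 1/z)^B dz`, over the counterclockwise circle
about `0` of radius `|1-u|/2` (which has `0` inside and `1 - u` outside when `u ≠ 1`). -/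
def f (A B : ℕ) (u : ℂ) : ℂ :=
  (2 * Real.pi * Complex.I)⁻¹ *
    ∮ z in C(0, ‖1 - u‖ / 2), (1 + 1 / (z + u - 1)) ^ A * (1 - 1 / z) ^ B

end Laguerre

end

/-!
By Andréief's identity, the integrals defining `Z` and `⟨tr e^{NuH}⟩` are expressed through the
one-dimensional integrals `∫ L_j L_k e^{-s x} dx` of the Laguerre polynomials, for `s = 1` and
`s = 1 - u`. Orthogonality at `s = 1` leaves the mean as the sum over `k < N` of the Laplace
transforms of `L_k ^ 2` at `s = 1 - u`.

With `a = 1 / z`, the Laplace transform of `L_k` at `z` is `a (1 - a) ^ k`. The Laplace transform of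
a product is the convolution of the Laplace transforms along the contour, so with `b = 1 / (s - z)`
that of `L_k ^ 2` is the contour integral of `a b ((1 - a) (1 - b)) ^ k`. As `s a b = a + b`, also
`(1 - a) (1 - b) - 1 = (1 - s) a b`, whence the sum over `k` telescopes to the contour integral of
`((1 - a) (1 - b)) ^ N / u`.
-/

namespace Laguerre

section ResidueFunctional

variable {K A : Type*} [Field K] [CommRing A] [Algebra K A]

/-- An algebraic model of the residue at the pole `0` of functions with poles at `0` and `s`:
`a` and `b` stand for `1 / z` and `1 / (s - z)`, and `I` for `g ↦ (1 / 2πi) ∮ g(z) dz` along a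
contour around `0` but not around `s`. -/
structure IsResidueFunctional (s : K) (a b : A) (I : A →ₗ[K] K) : Prop where
  smul_mul : s • (a * b) = a + b
  map_one : I 1 = 0
  map_left : I a = 1
  map_left_pow (n : ℕ) : I (a ^ (n + 2)) = 0
  map_right_pow (n : ℕ) : I (b ^ (n + 1)) = 0

theorem map_pow_mul_one_sub_pow_eq_zero {I : A →ₗ[K] K} {a : A} {m : ℕ}
    (hI : ∀ n, I (a ^ (n + m)) = 0) (n k : ℕ) : I (a ^ (n + m) * (1 - a) ^ k) = 0 := by
  induction k generalizing n with
  | zero => simpa using hI n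
  | succ k ih =>
    have hsplit : a ^ (n + m) * (1 - a) ^ (k + 1) =
        a ^ (n + m) * (1 - a) ^ k - a ^ (n + 1 + m) * (1 - a) ^ k := by ring
    rw [hsplit, map_sub, ih, ih, sub_zero]

namespace IsResidueFunctional

variable {s : K} {a b : A} {I : A →ₗ[K] K}

theorem mul_eq_inv_smul_add (hI : IsResidueFunctional s a b I) (hs : s ≠ 0) :
    a * b = s⁻¹ • (a + b) := by
  rw [← hI.smul_mul, inv_smul_smul₀ hs]

theorem map_pow_succ_mul_pow_succ (hI : IsResidueFunctional s a b I) (hs : s ≠ 0) (i j : ℕ) :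
    I (a ^ (i + 1) * b ^ (j + 1)) =
      s⁻¹ * (I (a ^ (i + 1) * b ^ j) + I (a ^ i * b ^ (j + 1))) := by
  have hsplit : a ^ (i + 1) * b ^ (j + 1) =
      s⁻¹ • (a ^ (i + 1) * b ^ j + a ^ i * b ^ (j + 1)) := by
    calc a ^ (i + 1) * b ^ (j + 1) = a ^ i * b ^ j * (a * b) := by ring
      _ = s⁻¹ • (a ^ i * b ^ j * (a + b)) := by
        rw [hI.mul_eq_inv_smul_add hs, mul_smul_comm]
      _ = _ := by congr 1; ring
  rw [hsplit, map_smul, map_add, smul_eq_mul]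

theorem map_pow_mul_pow (hI : IsResidueFunctional s a b I) (hs : s ≠ 0) (i j : ℕ) :
    I (a ^ (i + 1) * b ^ (j + 1)) = (i + j).choose i * s⁻¹ ^ (i + j + 1) := by
  rw [hI.map_pow_succ_mul_pow_succ hs]
  match i, j with
  | 0, 0 => simp [hI.map_left, by simpa using hI.map_right_pow 0]
  | 0, j + 1 =>
    rw [hI.map_pow_mul_pow hs 0 j, pow_zero, one_mul, hI.map_right_pow]
    simp [pow_succ']
  | i + 1, 0 =>
    rw [hI.map_pow_mul_pow hs i 0, pow_zero, mul_one, hI.map_left_pow]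
    simp [pow_succ']
  | i + 1, j + 1 =>
    rw [hI.map_pow_mul_pow hs (i + 1) j, hI.map_pow_mul_pow hs i (j + 1),
      show i + 1 + (j + 1) = i + j + 1 + 1 by ring, Nat.choose_succ_succ,
      show i + 1 + j = i + j + 1 by ring, show i + (j + 1) = i + j + 1 by ring]
    push_cast
    ring

/-- At `s = 1` the factors `1 - a` and `1 - b` are inverse to each other, so only a power of one
of them survives. -/
theorem map_mul_mul_one_sub_pow (hI : IsResidueFunctional 1 a b I) (k l : ℕ) :
    I (a * b * ((1 - a) ^ k * (1 - b) ^ l)) = if k = l then 1 else 0 := by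
  have hab : a * b = a + b := by simpa using hI.smul_mul
  have hinv : (1 - a) * (1 - b) = 1 := by linear_combination hab
  have hcancel (n m : ℕ) : (1 - a) ^ (n + m) * (1 - b) ^ n = (1 - a) ^ m ∧
      (1 - a) ^ n * (1 - b) ^ (n + m) = (1 - b) ^ m := by
    constructor
    · rw [pow_add, mul_right_comm, ← mul_pow, hinv, one_pow, one_mul]
    · rw [pow_add, ← mul_assoc, ← mul_pow, hinv, one_pow, one_mul]
  rcases lt_trichotomy k l with hkl | rfl | hkl
  · obtain ⟨m, rfl⟩ := Nat.exists_eq_add_of_lt hkl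
    have hb : a * b * (1 - b) ^ (m + 1) = -(b ^ (0 + 2) * (1 - b) ^ m) := by
      linear_combination (1 - b) ^ m * ((1 - b) * hab - hab)
    rw [if_neg hkl.ne, add_assoc, (hcancel k (m + 1)).2, hb, map_neg,
      map_pow_mul_one_sub_pow_eq_zero (fun n => hI.map_right_pow (n + 1)), neg_zero]
  · rw [if_pos rfl, ← mul_pow, hinv, one_pow, mul_one, hab, map_add, hI.map_left,
      show I b = 0 by simpa using hI.map_right_pow 0, add_zero]
  · obtain ⟨m, rfl⟩ := Nat.exists_eq_add_of_lt hkl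
    have ha : a * b * (1 - a) ^ (m + 1) = -(a ^ (0 + 2) * (1 - a) ^ m) := by
      linear_combination (1 - a) ^ m * ((1 - a) * hab - hab)
    rw [if_neg hkl.ne', add_assoc, (hcancel l (m + 1)).1, ha, map_neg,
      map_pow_mul_one_sub_pow_eq_zero hI.map_left_pow, neg_zero]

theorem map_one_sub_pow_mul_one_sub_pow (hI : IsResidueFunctional s a b I) (N : ℕ) :
    I ((1 - a) ^ N * (1 - b) ^ N) =
      (1 - s) * ∑ k ∈ Finset.range N, I (a * b * ((1 - a) ^ k * (1 - b) ^ k)) := by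
  have hq : (1 - a) * (1 - b) - 1 = (1 - s) • (a * b) := by
    rw [sub_smul, one_smul, hI.smul_mul]
    ring
  have hgeom : (1 - a) ^ N * (1 - b) ^ N =
      1 + (1 - s) • ∑ k ∈ Finset.range N, a * b * ((1 - a) ^ k * (1 - b) ^ k) := by
    simp only [← mul_pow, ← Finset.mul_sum]
    rw [← smul_mul_assoc, ← hq, mul_geom_sum, add_sub_cancel]
  rw [hgeom, map_add, hI.map_one, zero_add, map_smul, map_sum, smul_eq_mul]

end IsResidueFunctional

end ResidueFunctional

section FormalLaplace

open Polynomial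

variable {K A : Type*} [Field K] [CommRing A] [Algebra K A]

/-- The Laplace transform of polynomials with the variable `s` replaced by `a⁻¹`: it sends `X ^ n`
to `n! a ^ (n + 1)`, as `∫₀^∞ x ^ n e^{-s x} dx = n! / s ^ (n + 1)`. -/
noncomputable def formalLaplace (a : A) : K[X] →ₗ[K] A :=
  Polynomial.lsum fun n => LinearMap.toSpanSingleton K A (n.factorial • a ^ (n + 1))

theorem formalLaplace_monomial (a : A) (n : ℕ) (c : K) :
    formalLaplace a (monomial n c) = c • n.factorial • a ^ (n + 1) := by
  simp [formalLaplace]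

/-- The Laplace transform turns a pointwise product into a convolution along the contour: the
binomial coefficient of `map_pow_mul_pow` turns `i! j!` into `(i + j)!`. -/
theorem IsResidueFunctional.map_formalLaplace_mul {s : K} {a b : A} {I : A →ₗ[K] K}
    (hI : IsResidueFunctional s a b I) (hs : s ≠ 0) (p q : K[X]) :
    I (formalLaplace a p * formalLaplace b q) = formalLaplace s⁻¹ (p * q) := by
  induction p using Polynomial.induction_on' with
  | add p p' hp hp' => simp only [map_add, add_mul, hp, hp']
  | monomial i c =>
    induction q using Polynomial.induction_on' with
    | add q q' hq hq' => simp only [map_add, mul_add, hq, hq']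
    | monomial j d =>
      have hbinom : ((i + j).factorial : K) =
          (i + j).choose i * i.factorial * j.factorial := by
        rw [Nat.choose_symm_add, ← Nat.add_choose_mul_factorial_mul_factorial i j]
        push_cast
        rfl
      simp only [monomial_mul_monomial, formalLaplace_monomial, smul_mul_smul_comm, map_smul,
        map_nsmul, hI.map_pow_mul_pow hs]
      simp only [smul_eq_mul, nsmul_eq_mul, hbinom]
      push_cast
      ring

/-- The Laguerre polynomial `L_k(X) = ∑_i (-1)^i (k choose i) X^i / i!`. -/
noncomputable def laguerre (K : Type*) [Field K] (k : ℕ) : K[X] :=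
  ∑ i ∈ Finset.range (k + 1), monomial i ((-1) ^ i * k.choose i / i.factorial)

theorem natDegree_laguerre_le (k : ℕ) : (laguerre K k).natDegree ≤ k :=
  natDegree_sum_le_of_forall_le _ _ fun _ hi =>
    (natDegree_monomial_le _).trans (Nat.lt_succ_iff.1 (Finset.mem_range.1 hi))

theorem coeff_laguerre_self (k : ℕ) : (laguerre K k).coeff k = (-1) ^ k / k.factorial := by
  simp [laguerre, coeff_monomial]

theorem formalLaplace_laguerre [CharZero K] (a : A) (k : ℕ) :
    formalLaplace a (laguerre K k) = a * (1 - a) ^ k := by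
  rw [laguerre, map_sum, sub_eq_neg_add, add_pow, Finset.mul_sum]
  refine Finset.sum_congr rfl fun i _ => ?_
  have hi : (i.factorial : K) ≠ 0 := by exact_mod_cast i.factorial_ne_zero
  rw [formalLaplace_monomial, ← Nat.cast_smul_eq_nsmul K, smul_smul, div_mul_cancel₀ _ hi,
    Algebra.smul_def]
  simp only [map_mul, map_pow, map_neg, map_one, map_natCast, one_pow, mul_one]
  rw [neg_pow a]
  ring

theorem IsResidueFunctional.formalLaplace_laguerre_mul_laguerre [CharZero K] {s : K} {a b : A}
    {I : A →ₗ[K] K} (hI : IsResidueFunctional s a b I) (hs : s ≠ 0) (k l : ℕ) :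
    formalLaplace s⁻¹ (laguerre K k * laguerre K l) =
      I (a * b * ((1 - a) ^ k * (1 - b) ^ l)) := by
  rw [← hI.map_formalLaplace_mul hs, formalLaplace_laguerre, formalLaplace_laguerre,
    mul_mul_mul_comm]

end FormalLaplace

section Contour

open Complex

variable {a : ℂ} {γ : Path a a}

theorem contourIntegral_eq_intervalIntegral (γ : Path a a) (g : ℂ → ℂ) :
    contourIntegral γ g = ∫ t in (0 : ℝ)..1, deriv γ.extend t * g (γ.extend t) := by
  rw [contourIntegral, curveIntegral_eq_intervalIntegral_deriv]
  simp

theorem IsPiecewiseC1.intervalIntegrable_deriv (hγ : IsPiecewiseC1 γ) :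
    IntervalIntegrable (deriv γ.extend) volume 0 1 :=
  hγ.2

/-- The normalised contour integral `(1 / 2πi) ∫ γ'(t) g(t) dt` as a linear functional of the
continuous function `g` of the parameter `t`; functions of `z` enter through `t ↦ g (γ t)`. -/
noncomputable def contourFunctional (γ : Path a a)
    (hγ : IntervalIntegrable (deriv γ.extend) volume 0 1) : C(unitInterval, ℂ) →ₗ[ℂ] ℂ where
  toFun g := (2 * Real.pi * I)⁻¹ *
    ∫ t in (0 : ℝ)..1, deriv γ.extend t * Set.IccExtend zero_le_one g t
  map_add' g h := by
    have hint (g : C(unitInterval, ℂ)) : IntervalIntegrable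
        (fun t => deriv γ.extend t * Set.IccExtend zero_le_one g t) volume 0 1 :=
      hγ.mul_continuousOn g.continuous.Icc_extend'.continuousOn
    rw [← mul_add, ← intervalIntegral.integral_add (hint g) (hint h)]
    simp only [← mul_add]
    rfl
  map_smul' c g := by
    have hc : ∫ t in (0 : ℝ)..1, deriv γ.extend t * Set.IccExtend zero_le_one (c • g) t =
        c * ∫ t in (0 : ℝ)..1, deriv γ.extend t * Set.IccExtend zero_le_one g t := by
      rw [← intervalIntegral.integral_const_mul]
      exact intervalIntegral.integral_congr fun t _ => mul_left_comm (deriv γ.extend t) c _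
    rw [RingHom.id_apply, smul_eq_mul, ← mul_left_comm, ← hc]

theorem contourFunctional_eq_contourIntegral
    (hγ : IntervalIntegrable (deriv γ.extend) volume 0 1) {G : C(unitInterval, ℂ)} {g : ℂ → ℂ}
    (hG : ∀ t, G t = g (γ t)) :
    contourFunctional γ hγ G = (2 * Real.pi * I)⁻¹ * contourIntegral γ g := by
  have hG' : ⇑G = g ∘ γ := funext hG
  simp only [contourFunctional, LinearMap.coe_mk, AddHom.coe_mk, hG',
    contourIntegral_eq_intervalIntegral]
  rfl

theorem IsPiecewiseC1.contourFunctional_deriv (hγ : IsPiecewiseC1 γ) {G : C(unitInterval, ℂ)}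
    {g : ℂ → ℂ} (hg : ∀ t, HasDerivAt g (G t) (γ t)) :
    contourFunctional γ hγ.intervalIntegrable_deriv G = 0 := by
  obtain ⟨S, hS⟩ := hγ.1
  have hd (t : ℝ) : HasDerivAt g (Set.IccExtend zero_le_one G t) (γ.extend t) := hg _
  have hint : ∫ t in (0 : ℝ)..1, deriv γ.extend t * Set.IccExtend zero_le_one G t =
      g (γ.extend 1) - g (γ.extend 0) := by
    refine integral_eq_of_hasDerivAt_off_countable_of_le (fun t => g (γ.extend t)) _ zero_le_one
      S.countable_toSet ?_ ?_
      (hγ.intervalIntegrable_deriv.mul_continuousOn G.continuous.Icc_extend'.continuousOn)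
    · exact fun t _ => ((hd t).continuousAt.comp
        γ.continuous_extend.continuousAt).continuousWithinAt
    · rintro t ⟨ht, htS⟩
      exact (hd t).scomp t ((hS t ht htS).differentiableAt one_ne_zero).hasDerivAt
  simp [contourFunctional, hint]

/-- The function `1 / (z - w)` along `γ`. -/
noncomputable def invSub (γ : Path a a) {w : ℂ} (hw : ∀ t, γ t ≠ w) : C(unitInterval, ℂ) where
  toFun t := (γ t - w)⁻¹
  continuous_toFun := (γ.continuous.sub continuous_const).inv₀ fun t => sub_ne_zero.2 (hw t)

theorem invSub_apply {w : ℂ} (hw : ∀ t, γ t ≠ w) (t : unitInterval) :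
    invSub γ hw t = (γ t - w)⁻¹ :=
  rfl

theorem contourFunctional_invSub (hγ : IntervalIntegrable (deriv γ.extend) volume 0 1) {w : ℂ}
    (hw : ∀ t, γ t ≠ w) : contourFunctional γ hγ (invSub γ hw) = windingNumber γ w :=
  contourFunctional_eq_contourIntegral hγ fun _ => rfl

theorem IsPiecewiseC1.contourFunctional_invSub_pow (hγ : IsPiecewiseC1 γ) {w : ℂ}
    (hw : ∀ t, γ t ≠ w) (n : ℕ) :
    contourFunctional γ hγ.intervalIntegrable_deriv (invSub γ hw ^ (n + 2)) = 0 := by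
  refine hγ.contourFunctional_deriv (g := fun z => -(n + 1 : ℂ)⁻¹ * (z - w)⁻¹ ^ (n + 1))
    fun t => ?_
  have hn : (n + 1 : ℂ) ≠ 0 := n.cast_add_one_ne_zero
  have hd := ((((hasDerivAt_id (γ t)).sub_const w).inv (sub_ne_zero.2 (hw t))).pow
    (n + 1)).const_mul (-(n + 1 : ℂ)⁻¹)
  refine hd.congr_deriv ?_
  simp only [ContinuousMap.pow_apply, invSub_apply, id, Pi.inv_apply]
  push_cast
  rw [pow_add, inv_pow _ 2]
  field_simp

theorem IsContour.isResidueFunctional {u : ℂ} (hγ : IsContour u γ) :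
    IsResidueFunctional (1 - u) (invSub γ hγ.avoids_zero) (-invSub γ hγ.avoids_pole)
      (contourFunctional γ hγ.piecewiseC1.intervalIntegrable_deriv) where
  smul_mul := by
    ext t
    have h0 : γ t - 0 ≠ 0 := sub_ne_zero.2 (hγ.avoids_zero t)
    have h1 : γ t - (1 - u) ≠ 0 := sub_ne_zero.2 (hγ.avoids_pole t)
    simp only [ContinuousMap.smul_apply, ContinuousMap.mul_apply, ContinuousMap.neg_apply,
      ContinuousMap.add_apply, invSub_apply, smul_eq_mul]
    field_simp
    ring
  map_one := hγ.piecewiseC1.contourFunctional_deriv fun t => hasDerivAt_id (γ t)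
  map_left := by rw [contourFunctional_invSub, hγ.winding_zero]
  map_left_pow := hγ.piecewiseC1.contourFunctional_invSub_pow _
  map_right_pow n := by
    rw [← neg_one_smul ℂ, smul_pow, map_smul]
    match n with
    | 0 => rw [zero_add, pow_one, pow_one, contourFunctional_invSub, hγ.winding_pole, smul_zero]
    | n + 1 => rw [hγ.piecewiseC1.contourFunctional_invSub_pow, smul_zero]

end Contour

section Circle

open Complex

/-- The counterclockwise circle of radius `R` about `0`, as a closed path. -/
noncomputable def circlePath (R : ℝ) : Path (R : ℂ) R where
  toFun t := circleMap 0 R (2 * Real.pi * t)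
  source' := by simp [circleMap]
  target' := by simp [circleMap]

theorem norm_circlePath {R : ℝ} (hR : 0 ≤ R) (t : unitInterval) : ‖circlePath R t‖ = R := by
  simp [circlePath, abs_of_nonneg hR]

theorem extend_circlePath (R : ℝ) {t : ℝ} (ht : t ∈ Set.Icc (0 : ℝ) 1) :
    (circlePath R).extend t = circleMap 0 R (2 * Real.pi * t) :=
  (circlePath R).extend_apply ht

theorem extend_circlePath_eventuallyEq (R : ℝ) {t : ℝ} (ht : t ∈ Set.Ioo (0 : ℝ) 1) :
    (circlePath R).extend =ᶠ[nhds t] fun t => circleMap 0 R (2 * Real.pi * t) := by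
  filter_upwards [Icc_mem_nhds ht.1 ht.2] with x hx
  exact extend_circlePath R hx

theorem deriv_extend_circlePath (R : ℝ) {t : ℝ} (ht : t ∈ Set.Ioo (0 : ℝ) 1) :
    deriv (circlePath R).extend t = 2 * Real.pi * deriv (circleMap 0 R) (2 * Real.pi * t) := by
  rw [(extend_circlePath_eventuallyEq R ht).deriv_eq, deriv_comp_mul_left]
  simp

theorem isPiecewiseC1_circlePath (R : ℝ) : IsPiecewiseC1 (circlePath R) := by
  refine ⟨⟨∅, fun t ht _ => ?_⟩, ?_⟩
  · have hsmooth : ContDiff ℝ 1 fun t : ℝ => circleMap 0 R (2 * Real.pi * t) :=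
      (contDiff_circleMap 0 R).comp (contDiff_const.mul contDiff_id)
    exact hsmooth.contDiffAt.congr_of_eventuallyEq (extend_circlePath_eventuallyEq R ht)
  · have hcont : Continuous fun t : ℝ => 2 * Real.pi * deriv (circleMap 0 R) (2 * Real.pi * t) := by
      simp only [deriv_circleMap]
      fun_prop
    refine (hcont.intervalIntegrable 0 1).congr_uIoo fun t ht => ?_
    rw [Set.uIoo_of_le zero_le_one] at ht
    exact (deriv_extend_circlePath R ht).symm

theorem contourIntegral_circlePath (R : ℝ) (g : ℂ → ℂ) :
    contourIntegral (circlePath R) g = ∮ z in C(0, R), g z := by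
  have hparam : ∫ t in (0 : ℝ)..1, deriv (circlePath R).extend t * g ((circlePath R).extend t) =
      ∫ t in (0 : ℝ)..1, (2 * Real.pi : ℝ) * (deriv (circleMap 0 R) (2 * Real.pi * t) •
        g (circleMap 0 R (2 * Real.pi * t))) := by
    refine intervalIntegral.integral_congr_Ioo_of_le zero_le_one fun t ht => ?_
    rw [deriv_extend_circlePath R ht, extend_circlePath R (Set.Ioo_subset_Icc_self ht)]
    push_cast
    exact mul_assoc _ _ _
  rw [contourIntegral_eq_intervalIntegral, hparam, intervalIntegral.integral_const_mul]
  simpa [circleIntegral] using intervalIntegral.smul_integral_comp_mul_left (a := 0) (b := 1)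
    (fun θ => deriv (circleMap 0 R) θ • g (circleMap 0 R θ)) (2 * Real.pi)

theorem windingNumber_circlePath_zero {R : ℝ} (hR : R ≠ 0) :
    windingNumber (circlePath R) 0 = 1 := by
  rw [windingNumber, contourIntegral_circlePath, circleIntegral.integral_sub_center_inv _ hR,
    inv_mul_cancel₀ two_pi_I_ne_zero]

theorem windingNumber_circlePath_of_lt_norm {R : ℝ} (hR : 0 ≤ R) {w : ℂ} (hw : R < ‖w‖) :
    windingNumber (circlePath R) w = 0 := by
  have hne : ∀ z ∈ Metric.closedBall (0 : ℂ) R, z - w ≠ 0 := fun z hz => by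
    rw [mem_closedBall_zero_iff] at hz
    exact sub_ne_zero.2 fun h => (h ▸ hz).not_gt hw
  have hzero : ∮ z in C(0, R), (z - w)⁻¹ = 0 :=
    circleIntegral_eq_zero_of_differentiable_on_off_countable hR Set.countable_empty
      ((continuousOn_id.sub continuousOn_const).inv₀ hne) fun z hz =>
        (differentiableAt_id.sub_const w).inv (hne z (Metric.ball_subset_closedBall hz.1))
  rw [windingNumber, contourIntegral_circlePath, hzero, mul_zero]

theorem isContour_circlePath {u : ℂ} {R : ℝ} (hR : 0 < R) (hRu : R < ‖1 - u‖) :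
    IsContour u (circlePath R) where
  piecewiseC1 := isPiecewiseC1_circlePath R
  avoids_zero t h := hR.ne' (by simpa [norm_circlePath hR.le] using congrArg norm h)
  avoids_pole t h := hRu.ne (by simpa [norm_circlePath hR.le] using congrArg norm h)
  winding_zero := windingNumber_circlePath_zero hR.ne'
  winding_pole := windingNumber_circlePath_of_lt_norm hR.le hRu

end Circle

section ContourFormula

variable {u a : ℂ} {γ : Path a a}

theorem IsContour.contourIntegral_eq_sum_formalLaplace (hγ : IsContour u γ) (hu : u ≠ 1) (N : ℕ) :
    (2 * Real.pi * Complex.I)⁻¹ *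
        contourIntegral γ (fun z => (1 + 1 / (z + u - 1)) ^ N * (1 - 1 / z) ^ N) =
      u * ∑ k ∈ Finset.range N, formalLaplace (1 - u)⁻¹ (laguerre ℂ k * laguerre ℂ k) := by
  have hI := hγ.isResidueFunctional
  have hs : 1 - u ≠ 0 := sub_ne_zero.2 hu.symm
  have hsum := hI.map_one_sub_pow_mul_one_sub_pow N
  simp only [← hI.formalLaplace_laguerre_mul_laguerre hs, sub_sub_cancel] at hsum
  rw [← hsum]
  refine (contourFunctional_eq_contourIntegral _ fun t => ?_).symm
  simp only [ContinuousMap.mul_apply, ContinuousMap.pow_apply, ContinuousMap.sub_apply,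
    ContinuousMap.add_apply, ContinuousMap.one_apply, invSub_apply, sub_zero, sub_neg_eq_add,
    one_div, sub_sub_eq_add_sub]
  exact mul_comm _ _

theorem contourIntegral_congr {g h : ℂ → ℂ} (hgh : ∀ t, g (γ t) = h (γ t)) :
    contourIntegral γ g = contourIntegral γ h := by
  rw [contourIntegral_eq_intervalIntegral, contourIntegral_eq_intervalIntegral]
  exact intervalIntegral.integral_congr fun _ _ => congrArg _ (hgh _)

theorem IsContour.contourIntegral_quotient_eq (hγ : IsContour u γ) (N : ℕ) :
    contourIntegral γ (fun z => (1 - z) ^ N / (1 - z - u) ^ N * ((z + u) ^ N / z ^ N)) =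
      contourIntegral γ (fun z => (1 + 1 / (z + u - 1)) ^ N * (1 - 1 / z) ^ N) := by
  refine contourIntegral_congr fun t => ?_
  have hz : γ t ≠ 0 := hγ.avoids_zero t
  have hpole : γ t + u - 1 ≠ 0 := fun h => hγ.avoids_pole t (by linear_combination h)
  have hpole' : 1 - γ t - u ≠ 0 := fun h => hγ.avoids_pole t (by linear_combination -h)
  rw [← div_pow, ← div_pow, ← mul_pow, ← mul_pow]
  congr 1
  field_simp
  ring

theorem formalLaplace_one_laguerre_mul_laguerre (k l : ℕ) :
    formalLaplace (1 : ℂ) (laguerre ℂ k * laguerre ℂ l) = if k = l then 1 else 0 := by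
  have hcircle : IsContour 0 (circlePath (1 / 2)) :=
    isContour_circlePath one_half_pos (by norm_num)
  have hI := hcircle.isResidueFunctional
  simp only [sub_zero] at hI
  rw [← hI.map_mul_mul_one_sub_pow, ← hI.formalLaplace_laguerre_mul_laguerre one_ne_zero, inv_one]

end ContourFormula

section LaplaceIntegral

open Set Polynomial

variable {s : ℂ}

theorem tendsto_pow_mul_cexp_neg_mul_atTop (n : ℕ) (hs : 0 < s.re) :
    Filter.Tendsto (fun x : ℝ => (x : ℂ) ^ n * Complex.exp (-s * x)) Filter.atTop (nhds 0) := by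
  rw [tendsto_zero_iff_norm_tendsto_zero]
  refine (tendsto_rpow_mul_exp_neg_mul_atTop_nhds_zero n s.re hs).congr' ?_
  filter_upwards [Filter.eventually_ge_atTop 0] with x hx
  simp [Complex.norm_exp, abs_of_nonneg hx]

theorem integrableOn_pow_mul_cexp_neg_mul (n : ℕ) (hs : 0 < s.re) :
    IntegrableOn (fun x : ℝ => (x : ℂ) ^ n * Complex.exp (-s * x)) (Ioi 0) := by
  refine (integrableOn_rpow_mul_exp_neg_mul_rpow (s := n) (p := 1)
    (neg_one_lt_zero.trans_le n.cast_nonneg) one_pos hs).mono' (by fun_prop) ?_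
  filter_upwards [ae_restrict_mem measurableSet_Ioi] with x hx
  simp [Complex.norm_exp, abs_of_nonneg (mem_Ioi.1 hx).le]

theorem integral_pow_succ_mul_cexp_neg_mul (n : ℕ) (hs : 0 < s.re) :
    s * ∫ x : ℝ in Ioi 0, (x : ℂ) ^ (n + 1) * Complex.exp (-s * x) =
      (n + 1) * ∫ x : ℝ in Ioi 0, (x : ℂ) ^ n * Complex.exp (-s * x) := by
  have hderiv (x : ℝ) : HasDerivAt (fun x : ℝ => (x : ℂ) ^ (n + 1) * Complex.exp (-s * x))
      ((n + 1) * ((x : ℂ) ^ n * Complex.exp (-s * x)) -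
        s * ((x : ℂ) ^ (n + 1) * Complex.exp (-s * x))) x := by
    have hx := Complex.ofRealCLM.hasDerivAt (x := x)
    refine ((hx.fun_pow (n + 1)).mul (hx.const_mul (-s)).cexp).congr_deriv ?_
    simp only [Complex.ofRealCLM_apply, Complex.ofReal_one, Nat.cast_add_one, add_tsub_cancel_right]
    ring
  have hn := (integrableOn_pow_mul_cexp_neg_mul n hs).const_mul ((n : ℂ) + 1)
  have hn' := (integrableOn_pow_mul_cexp_neg_mul (n + 1) hs).const_mul s
  have hparts := integral_Ioi_of_hasDerivAt_of_tendsto' (a := 0) (fun x _ => hderiv x)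
    (hn.sub hn') (tendsto_pow_mul_cexp_neg_mul_atTop (n + 1) hs)
  rw [integral_sub hn hn', integral_const_mul, integral_const_mul] at hparts
  simp only [Complex.ofReal_zero, zero_pow n.succ_ne_zero, zero_mul, sub_zero] at hparts
  exact (sub_eq_zero.1 hparts).symm

theorem integral_pow_mul_cexp_neg_mul (n : ℕ) (hs : 0 < s.re) :
    ∫ x : ℝ in Ioi 0, (x : ℂ) ^ n * Complex.exp (-s * x) = n.factorial * s⁻¹ ^ (n + 1) := by
  have hs0 : s ≠ 0 := fun h => by simp [h] at hs
  induction n with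
  | zero =>
    simpa [neg_div_neg_eq] using integral_exp_mul_complex_Ioi (a := -s) (by simpa using hs) 0
  | succ n ih =>
    refine mul_left_cancel₀ hs0 ?_
    rw [integral_pow_succ_mul_cexp_neg_mul n hs, ih, Nat.factorial_succ, pow_succ s⁻¹ (n + 1)]
    push_cast
    field_simp

theorem integrableOn_eval_mul_cexp_neg_mul (hs : 0 < s.re) (p : ℂ[X]) :
    IntegrableOn (fun x : ℝ => p.eval (x : ℂ) * Complex.exp (-s * x)) (Ioi 0) := by
  induction p using Polynomial.induction_on' with
  | add p q hp hq =>
    simp only [eval_add, add_mul]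
    exact hp.add hq
  | monomial n c =>
    simp only [eval_monomial, mul_assoc]
    exact (integrableOn_pow_mul_cexp_neg_mul n hs).const_mul c

theorem integral_eval_mul_cexp_neg_mul (hs : 0 < s.re) (p : ℂ[X]) :
    ∫ x : ℝ in Ioi 0, p.eval (x : ℂ) * Complex.exp (-s * x) = formalLaplace s⁻¹ p := by
  induction p using Polynomial.induction_on' with
  | add p q hp hq =>
    simp only [eval_add, add_mul, map_add, ← hp, ← hq]
    exact integral_add (integrableOn_eval_mul_cexp_neg_mul hs p)
      (integrableOn_eval_mul_cexp_neg_mul hs q)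
  | monomial n c =>
    simp only [eval_monomial, mul_assoc, integral_const_mul, integral_pow_mul_cexp_neg_mul n hs,
      formalLaplace_monomial, nsmul_eq_mul, smul_eq_mul]

end LaplaceIntegral

section Andreief

section Determinant

variable {ι α R : Type*}

/-- The matrix `(φ_k(x_i))_{i,k}`, whose determinant is the Slater determinant of the `φ_k`. -/
def evalMatrix (φ : ι → α → R) (x : ι → α) : Matrix ι ι R :=
  Matrix.of fun i k => φ k (x i)

/-- The family `ψ` in every row, with the row `l` multiplied by `g`: a factor `g (x l)` in front of
a Slater determinant is absorbed into the row that depends on `x l`. -/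
def mulRow [Mul R] [DecidableEq ι] (ψ : ι → α → R) (g : α → R) (l : ι) : ι → ι → α → R :=
  Function.update (fun _ => ψ) l fun k x => ψ k x * g x

variable [CommRing R] [Fintype ι] [DecidableEq ι]

theorem det_mul_det_eq_sum_perm (A B : Matrix ι ι R) :
    A.det * B.det = ∑ σ : Equiv.Perm ι,
      (Equiv.Perm.sign σ : R) * (Matrix.of fun i k => A i (σ i) * B i k).det := by
  rw [← A.det_transpose, Matrix.det_apply', Finset.sum_mul]
  refine Finset.sum_congr rfl fun σ _ => ?_
  rw [mul_assoc, Matrix.det_mul_column]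
  rfl

theorem sum_det_updateRow_eq_trace_adjugate_mul (M B : Matrix ι ι R) :
    ∑ l, (M.updateRow l (B l)).det = (M.adjugate * B).trace := by
  have hcramer (l : ι) : (M.updateRow l (B l)).det = (B * M.adjugate) l l := by
    rw [← Matrix.cramer_transpose_apply, Matrix.cramer_eq_adjugate_mulVec,
      ← Matrix.adjugate_transpose, Matrix.mulVec_transpose]
    rfl
  simp only [hcramer]
  exact Matrix.trace_mul_comm _ _

theorem sign_mul_det_submatrix (σ : Equiv.Perm ι) (M : Matrix ι ι R) :
    (Equiv.Perm.sign σ : R) * (M.submatrix σ id).det = M.det := by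
  rw [Matrix.det_permute, ← mul_assoc]
  norm_cast
  simp

theorem det_mulRow (ψ : ι → α → R) (g : α → R) (x : ι → α) (l : ι) :
    (Matrix.of fun i k => mulRow ψ g l i k (x i)).det = (evalMatrix ψ x).det * g (x l) := by
  have hrow : (Matrix.of fun i k => mulRow ψ g l i k (x i)) =
      (evalMatrix ψ x).updateRow l (g (x l) • evalMatrix ψ x l) := by
    ext i k
    rcases eq_or_ne i l with rfl | hil
    · simp [mulRow, evalMatrix, mul_comm]
    · simp [mulRow, evalMatrix, hil]
  rw [hrow, Matrix.det_updateRow_smul, Matrix.updateRow_eq_self, mul_comm]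

end Determinant

variable {ι α 𝕜 : Type*} [RCLike 𝕜] [MeasurableSpace α] {μ : Measure α}

/-- The matrix of the integrals `∫ φ_j ψ_k dμ`. -/
noncomputable def gramMatrix (μ : Measure α) (φ ψ : ι → α → 𝕜) : Matrix ι ι 𝕜 :=
  Matrix.of fun j k => ∫ x, φ j x * ψ k x ∂μ

variable {φ ψ : ι → α → 𝕜} {θ : ι → ι → α → 𝕜} {g : α → 𝕜} [DecidableEq ι]

theorem integrable_mul_mulRow (hint : ∀ j k, Integrable (fun x => φ j x * ψ k x) μ)
    (hintg : ∀ j k, Integrable (fun x => φ j x * (ψ k x * g x)) μ) (l i j k : ι) :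
    Integrable (fun x => φ j x * mulRow ψ g l i k x) μ := by
  rcases eq_or_ne i l with rfl | hil
  · simpa [mulRow] using hintg j k
  · simpa [mulRow, hil] using hint j k

variable [Fintype ι] [SigmaFinite μ]

theorem integrable_det_of_forall_integrable (hθ : ∀ i k, Integrable (θ i k) μ) :
    Integrable (fun x : ι → α => (Matrix.of fun i k => θ i k (x i)).det)
      (Measure.pi fun _ => μ) := by
  simp only [← Matrix.det_transpose (Matrix.of _), Matrix.det_apply']
  exact integrable_finsetSum _ fun σ _ =>
    (Integrable.fintype_prod fun i => hθ i (σ i)).const_mul _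

theorem integral_det_of_forall_integrable (hθ : ∀ i k, Integrable (θ i k) μ) :
    ∫ x : ι → α, (Matrix.of fun i k => θ i k (x i)).det ∂(Measure.pi fun _ => μ) =
      (Matrix.of fun i k => ∫ x, θ i k x ∂μ).det := by
  simp only [← Matrix.det_transpose (Matrix.of _), Matrix.det_apply']
  rw [integral_finsetSum _ fun σ _ =>
    (Integrable.fintype_prod fun i => hθ i (σ i)).const_mul _]
  refine Finset.sum_congr rfl fun σ _ => ?_
  rw [integral_const_mul]
  congr 1
  exact integral_fintype_prod_eq_prod (fun i x => θ i (σ i) x)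

theorem integrable_det_evalMatrix_mul_det
    (hint : ∀ i j k, Integrable (fun x => φ j x * θ i k x) μ) :
    Integrable (fun x : ι → α =>
      (evalMatrix φ x).det * (Matrix.of fun i k => θ i k (x i)).det) (Measure.pi fun _ => μ) := by
  simp only [det_mul_det_eq_sum_perm]
  exact integrable_finsetSum _ fun σ _ =>
    (integrable_det_of_forall_integrable fun i k => hint i (σ i) k).const_mul _

theorem integral_det_evalMatrix_mul_det
    (hint : ∀ i j k, Integrable (fun x => φ j x * θ i k x) μ) :
    ∫ x : ι → α, (evalMatrix φ x).det * (Matrix.of fun i k => θ i k (x i)).det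
        ∂(Measure.pi fun _ => μ) =
      ∑ σ : Equiv.Perm ι, (Equiv.Perm.sign σ : 𝕜) *
        (Matrix.of fun i k => ∫ x, φ (σ i) x * θ i k x ∂μ).det := by
  simp only [det_mul_det_eq_sum_perm]
  rw [integral_finsetSum _ fun σ _ =>
    (integrable_det_of_forall_integrable fun i k => hint i (σ i) k).const_mul _]
  refine Finset.sum_congr rfl fun σ _ => ?_
  rw [integral_const_mul]
  congr 1
  exact integral_det_of_forall_integrable fun i k => hint i (σ i) k

theorem integral_det_evalMatrix_mul_det_evalMatrix
    (hint : ∀ j k, Integrable (fun x => φ j x * ψ k x) μ) :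
    ∫ x, (evalMatrix φ x).det * (evalMatrix ψ x).det ∂(Measure.pi fun _ => μ) =
      (Fintype.card ι).factorial * (gramMatrix μ φ ψ).det := by
  calc _ = ∑ σ : Equiv.Perm ι,
        (Equiv.Perm.sign σ : 𝕜) * ((gramMatrix μ φ ψ).submatrix σ id).det :=
      integral_det_evalMatrix_mul_det fun _ => hint
    _ = _ := by
      simp only [sign_mul_det_submatrix, Finset.sum_const, Finset.card_univ, Fintype.card_perm,
        nsmul_eq_mul]

theorem integrable_det_evalMatrix_mul_det_evalMatrix_mul
    (hint : ∀ j k, Integrable (fun x => φ j x * ψ k x) μ)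
    (hintg : ∀ j k, Integrable (fun x => φ j x * (ψ k x * g x)) μ) (l : ι) :
    Integrable (fun x : ι → α => (evalMatrix φ x).det * ((evalMatrix ψ x).det * g (x l)))
      (Measure.pi fun _ => μ) := by
  simp only [← det_mulRow]
  exact integrable_det_evalMatrix_mul_det (integrable_mul_mulRow hint hintg l)

theorem integrable_det_evalMatrix_mul_det_evalMatrix_mul_sum
    (hint : ∀ j k, Integrable (fun x => φ j x * ψ k x) μ)
    (hintg : ∀ j k, Integrable (fun x => φ j x * (ψ k x * g x)) μ) :
    Integrable (fun x : ι → α => (evalMatrix φ x).det * (evalMatrix ψ x).det * ∑ l, g (x l))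
      (Measure.pi fun _ => μ) := by
  simp only [Finset.mul_sum, mul_assoc]
  exact integrable_finsetSum _ fun l _ =>
    integrable_det_evalMatrix_mul_det_evalMatrix_mul hint hintg l

theorem integral_det_evalMatrix_mul_det_evalMatrix_mul
    (hint : ∀ j k, Integrable (fun x => φ j x * ψ k x) μ)
    (hintg : ∀ j k, Integrable (fun x => φ j x * (ψ k x * g x)) μ) (l : ι) :
    ∫ x : ι → α, (evalMatrix φ x).det * ((evalMatrix ψ x).det * g (x l))
        ∂(Measure.pi fun _ => μ) =
      ∑ σ : Equiv.Perm ι, ((gramMatrix μ φ ψ).updateRow (σ l)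
        (gramMatrix μ φ (fun k x => ψ k x * g x) (σ l))).det := by
  simp only [← det_mulRow]
  rw [integral_det_evalMatrix_mul_det (integrable_mul_mulRow hint hintg l)]
  refine Finset.sum_congr rfl fun σ _ => ?_
  rw [← sign_mul_det_submatrix σ (Matrix.updateRow _ _ _)]
  congr 2
  ext i k
  rcases eq_or_ne i l with rfl | hil
  · simp [gramMatrix, mulRow]
  · simp [gramMatrix, mulRow, hil, σ.injective.ne hil]

theorem integral_det_evalMatrix_mul_det_evalMatrix_mul_sum
    (hint : ∀ j k, Integrable (fun x => φ j x * ψ k x) μ)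
    (hintg : ∀ j k, Integrable (fun x => φ j x * (ψ k x * g x)) μ) :
    ∫ x : ι → α, (evalMatrix φ x).det * (evalMatrix ψ x).det * ∑ l, g (x l)
        ∂(Measure.pi fun _ => μ) =
      (Fintype.card ι).factorial *
        ((gramMatrix μ φ ψ).adjugate * gramMatrix μ φ fun k x => ψ k x * g x).trace := by
  simp only [Finset.mul_sum, mul_assoc]
  rw [integral_finsetSum _ fun l _ =>
    integrable_det_evalMatrix_mul_det_evalMatrix_mul hint hintg l]
  simp only [integral_det_evalMatrix_mul_det_evalMatrix_mul hint hintg]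
  rw [Finset.sum_comm, Finset.sum_congr rfl fun σ _ => Equiv.sum_comp σ fun l =>
    ((gramMatrix μ φ ψ).updateRow l (gramMatrix μ φ (fun k x => ψ k x * g x) l)).det]
  rw [Finset.sum_const, sum_det_updateRow_eq_trace_adjugate_mul, Finset.card_univ,
    Fintype.card_perm, nsmul_eq_mul]

end Andreief

section Ensemble

open Set Polynomial

theorem det_evalMatrix_mul {ι α R : Type*} [CommRing R] [Fintype ι] [DecidableEq ι]
    (φ : ι → α → R) (g : α → R) (x : ι → α) :
    (evalMatrix (fun k y => φ k y * g y) x).det = (evalMatrix φ x).det * ∏ i, g (x i) := by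
  rw [mul_comm, ← Matrix.det_mul_column]
  congr 1
  ext i k
  exact mul_comm _ _

theorem det_evalMatrix_eval {R : Type*} [CommRing R] {N : ℕ} {p : Fin N → R[X]}
    (hp : ∀ k, (p k).natDegree ≤ k) (x : Fin N → R) :
    (evalMatrix (fun k y => (p k).eval y) x).det =
      (Matrix.vandermonde x).det * ∏ k, (p k).coeff k := by
  have hfactor := Matrix.eval_matrixOfPolynomials_eq_vandermonde_mul_matrixOfPolynomials x p hp
  refine (congrArg Matrix.det hfactor).trans ?_
  rw [Matrix.det_mul,
    Matrix.det_of_isUpperTriangular (Matrix.matrixOfPolynomials_blockTriangular _ hp)]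
  rfl

theorem vandermonde_sq_eq_det_sq {N : ℕ} (lam : Fin N → ℝ) :
    vandermonde lam ^ 2 = (Matrix.vandermonde lam).det ^ 2 := by
  simp only [vandermonde, Matrix.det_vandermonde, ← Finset.prod_pow, sub_sq_comm]

theorem volume_restrict_orthant (N : ℕ) :
    (volume : Measure (Fin N → ℝ)).restrict (orthant N) =
      Measure.pi fun _ => volume.restrict (Ici 0) := by
  have hpi : orthant N = univ.pi fun _ => Ici 0 := by
    ext x
    simp [orthant, Pi.le_def]
  rw [hpi, volume_pi, Measure.restrict_pi_pi]

variable {N : ℕ} {u : ℂ}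

/-- The Laguerre polynomials rescaled to the weight `e^{-N x}`. -/
noncomputable def laguerreFun (N : ℕ) (k : Fin N) (x : ℝ) : ℂ :=
  (laguerre ℂ k).eval (N * x : ℂ)

/-- The functions dual to `laguerreFun` in `L²(0, ∞)`: the weight `e^{-N x}` is put entirely on one
of the two families of a biorthogonal pair. -/
noncomputable def laguerreDual (N : ℕ) (k : Fin N) (x : ℝ) : ℂ :=
  laguerreFun N k x * Complex.exp (-N * x)

theorem laguerreFun_eq_eval_comp (k : Fin N) (x : ℝ) :
    laguerreFun N k x = ((laguerre ℂ k).comp (C (N : ℂ) * X)).eval (x : ℂ) := by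
  simp [laguerreFun]

theorem det_evalMatrix_laguerreFun (lam : Fin N → ℝ) :
    (evalMatrix (laguerreFun N) lam).det = (Matrix.vandermonde lam).det *
      ∏ k : Fin N, (-1) ^ (k : ℕ) / ((k : ℕ).factorial : ℂ) * (N : ℂ) ^ (k : ℕ) := by
  have hdeg (k : Fin N) : ((laguerre ℂ k).comp (C (N : ℂ) * X)).natDegree ≤ k := by
    calc _ ≤ (laguerre ℂ k).natDegree * (C (N : ℂ) * X).natDegree := natDegree_comp_le
      _ ≤ k * 1 := Nat.mul_le_mul (natDegree_laguerre_le k)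
          ((natDegree_C_mul_le _ _).trans natDegree_X_le)
      _ = k := mul_one _
  have hcast : (Matrix.vandermonde fun i => (lam i : ℂ)).det = (Matrix.vandermonde lam).det := by
    simp [Matrix.det_vandermonde]
  have hdet := det_evalMatrix_eval hdeg fun i => (lam i : ℂ)
  simp only [comp_C_mul_X_coeff, coeff_laguerre_self, hcast] at hdet
  rw [← hdet]
  simp only [evalMatrix, laguerreFun_eq_eval_comp]

theorem det_evalMatrix_laguerreDual (lam : Fin N → ℝ) :
    (evalMatrix (laguerreDual N) lam).det =
      (evalMatrix (laguerreFun N) lam).det * Real.exp (-(N : ℝ) * ∑ i, lam i) := by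
  have hexp : ((Real.exp (-(N : ℝ) * ∑ i, lam i) : ℝ) : ℂ) =
      ∏ i, Complex.exp (-N * lam i) := by
    rw [← Complex.exp_sum, ← Finset.mul_sum]
    push_cast
    rfl
  rw [hexp]
  exact det_evalMatrix_mul (laguerreFun N) (fun x => Complex.exp (-N * x)) lam

theorem ofReal_weight_eq_det_mul_det (hN : N ≠ 0) (lam : Fin N → ℝ) :
    (weight N lam : ℂ) = ((∏ k : Fin N, ((k : ℕ).factorial : ℂ) / (N : ℂ) ^ (k : ℕ)) ^ 2) *
      ((evalMatrix (laguerreFun N) lam).det * (evalMatrix (laguerreDual N) lam).det) := by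
  have hscale : (∏ k : Fin N, ((k : ℕ).factorial : ℂ) / (N : ℂ) ^ (k : ℕ)) ^ 2 *
      (∏ k : Fin N, (-1) ^ (k : ℕ) / ((k : ℕ).factorial : ℂ) * (N : ℂ) ^ (k : ℕ)) ^ 2 = 1 := by
    rw [← mul_pow, ← Finset.prod_mul_distrib, ← Finset.prod_pow]
    refine Finset.prod_eq_one fun k _ => ?_
    have hfactorial : ((k : ℕ).factorial : ℂ) ≠ 0 := by exact_mod_cast (k : ℕ).factorial_ne_zero
    have hNpow : (N : ℂ) ^ (k : ℕ) ≠ 0 := by exact_mod_cast pow_ne_zero _ hN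
    field_simp
    rw [← pow_mul, mul_comm, pow_mul, neg_one_sq, one_pow]
  rw [det_evalMatrix_laguerreDual, det_evalMatrix_laguerreFun, weight, vandermonde_sq_eq_det_sq]
  push_cast
  linear_combination
    -(Matrix.vandermonde lam).det ^ 2 * Complex.exp (-N * ∑ i, (lam i : ℂ)) * hscale

theorem laguerreFun_mul_laguerreDual_mul_cexp (u : ℂ) (j k : Fin N) (x : ℝ) :
    laguerreFun N j x * (laguerreDual N k x * Complex.exp (N * u * x)) =
      (laguerre ℂ j * laguerre ℂ k).eval (((N : ℝ) * x : ℝ) : ℂ) *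
        Complex.exp (-(1 - u) * ((N : ℝ) * x : ℝ)) := by
  have hexp : Complex.exp (-(1 - u) * ((N : ℝ) * x : ℝ)) =
      Complex.exp (-N * x) * Complex.exp (N * u * x) := by
    rw [← Complex.exp_add]
    push_cast
    ring_nf
  rw [hexp, eval_mul, laguerreDual, laguerreFun, laguerreFun]
  push_cast
  ring

theorem integrableOn_laguerreFun_mul_laguerreDual_mul_cexp (hN : N ≠ 0) (hu : u.re < 1)
    (j k : Fin N) :
    IntegrableOn (fun x => laguerreFun N j x * (laguerreDual N k x * Complex.exp (N * u * x)))
      (Ici 0) := by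
  have hN' : 0 < (N : ℝ) := Nat.cast_pos.2 hN.pos
  simp only [laguerreFun_mul_laguerreDual_mul_cexp]
  rw [integrableOn_Ici_iff_integrableOn_Ioi]
  have h := integrableOn_eval_mul_cexp_neg_mul (s := 1 - u) (by simpa using hu)
    (laguerre ℂ j * laguerre ℂ k)
  exact (integrableOn_Ioi_comp_mul_left_iff (fun y : ℝ =>
    (laguerre ℂ j * laguerre ℂ k).eval (y : ℂ) * Complex.exp (-(1 - u) * y)) 0 hN').2
    (by rwa [mul_zero])

theorem integral_laguerreFun_mul_laguerreDual_mul_cexp (hN : N ≠ 0) (hu : u.re < 1)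
    (j k : Fin N) :
    ∫ x in Ici 0, laguerreFun N j x * (laguerreDual N k x * Complex.exp (N * u * x)) =
      (N : ℂ)⁻¹ * formalLaplace (1 - u)⁻¹ (laguerre ℂ j * laguerre ℂ k) := by
  have hN' : 0 < (N : ℝ) := Nat.cast_pos.2 hN.pos
  simp only [laguerreFun_mul_laguerreDual_mul_cexp]
  rw [integral_Ici_eq_integral_Ioi, ← integral_eval_mul_cexp_neg_mul (by simpa using hu)]
  refine (integral_comp_mul_left_Ioi (fun y : ℝ => (laguerre ℂ j * laguerre ℂ k).eval (y : ℂ) *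
    Complex.exp (-(1 - u) * y)) 0 hN').trans ?_
  simp

theorem integrableOn_laguerreFun_mul_laguerreDual (hN : N ≠ 0) (j k : Fin N) :
    IntegrableOn (fun x => laguerreFun N j x * laguerreDual N k x) (Ici 0) := by
  simpa using integrableOn_laguerreFun_mul_laguerreDual_mul_cexp (u := 0) hN (by simp) j k

theorem gramMatrix_laguerreFun_laguerreDual (hN : N ≠ 0) :
    gramMatrix (volume.restrict (Ici 0)) (laguerreFun N) (laguerreDual N) = (N : ℂ)⁻¹ • 1 := by
  ext j k
  have h := integral_laguerreFun_mul_laguerreDual_mul_cexp (u := 0) hN (by simp) j k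
  simp only [sub_zero, inv_one, formalLaplace_one_laguerre_mul_laguerre, mul_zero, zero_mul,
    Complex.exp_zero, mul_one] at h
  simp [gramMatrix, h, Matrix.one_apply, Fin.ext_iff]

theorem integrableOn_weight (hN : N ≠ 0) : IntegrableOn (weight N) (orthant N) := by
  have hcomplex : IntegrableOn (fun lam => (weight N lam : ℂ)) (orthant N) := by
    rw [IntegrableOn, volume_restrict_orthant]
    simp only [ofReal_weight_eq_det_mul_det hN]
    exact (integrable_det_evalMatrix_mul_det fun _ =>
      integrableOn_laguerreFun_mul_laguerreDual hN).const_mul _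
  exact hcomplex.re

theorem partitionFunction_eq (hN : N ≠ 0) :
    partitionFunction N = (∏ k : Fin N, ((k : ℕ).factorial : ℝ) / (N : ℝ) ^ (k : ℕ)) ^ 2 *
      (N.factorial * (N : ℝ)⁻¹ ^ N) := by
  apply Complex.ofReal_injective
  rw [partitionFunction, ← integral_complex_ofReal, volume_restrict_orthant]
  simp only [ofReal_weight_eq_det_mul_det hN]
  rw [integral_const_mul, integral_det_evalMatrix_mul_det_evalMatrix
    (integrableOn_laguerreFun_mul_laguerreDual hN), gramMatrix_laguerreFun_laguerreDual hN,
    Matrix.det_smul, Matrix.det_one, Fintype.card_fin]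
  push_cast
  ring

theorem partitionFunction_pos (hN : N ≠ 0) : 0 < partitionFunction N := by
  have : 0 < (N : ℝ) := Nat.cast_pos.2 hN.pos
  rw [partitionFunction_eq hN]
  positivity

theorem integrableOn_weight_mul_traceExp (hN : N ≠ 0) (hu : u.re < 1) :
    IntegrableOn (fun lam => (weight N lam : ℂ) * traceExp ((N : ℂ) * u) lam) (orthant N) := by
  rw [IntegrableOn, volume_restrict_orthant]
  simp only [ofReal_weight_eq_det_mul_det hN, mul_assoc (_ ^ 2 : ℂ), traceExp]
  exact (integrable_det_evalMatrix_mul_det_evalMatrix_mul_sum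
    (integrableOn_laguerreFun_mul_laguerreDual hN)
    (integrableOn_laguerreFun_mul_laguerreDual_mul_cexp hN hu)).const_mul _

theorem integral_weight_mul_traceExp (hN : N ≠ 0) (hu : u.re < 1) :
    ∫ lam in orthant N, (weight N lam : ℂ) * traceExp ((N : ℂ) * u) lam = partitionFunction N *
      ∑ k ∈ Finset.range N, formalLaplace (1 - u)⁻¹ (laguerre ℂ k * laguerre ℂ k) := by
  rw [volume_restrict_orthant]
  simp only [ofReal_weight_eq_det_mul_det hN, mul_assoc (_ ^ 2 : ℂ), traceExp]
  rw [integral_const_mul, integral_det_evalMatrix_mul_det_evalMatrix_mul_sum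
    (integrableOn_laguerreFun_mul_laguerreDual hN)
    (g := fun x : ℝ => Complex.exp (N * u * x))
    (integrableOn_laguerreFun_mul_laguerreDual_mul_cexp hN hu),
    gramMatrix_laguerreFun_laguerreDual hN, partitionFunction_eq hN, Matrix.adjugate_smul,
    Matrix.adjugate_one, Matrix.smul_mul, one_mul, Matrix.trace_smul]
  simp only [gramMatrix, Matrix.trace, Matrix.diag_apply, Matrix.of_apply,
    integral_laguerreFun_mul_laguerreDual_mul_cexp hN hu]
  rw [← Finset.mul_sum, Fin.sum_univ_eq_sum_range fun k =>
    formalLaplace (1 - u)⁻¹ (laguerre ℂ k * laguerre ℂ k), Fintype.card_fin, ← pow_sub_one_mul hN]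
  push_cast
  ring

theorem mean_traceExp (hN : N ≠ 0) (hu : u.re < 1) :
    mean N (traceExp ((N : ℂ) * u)) =
      ∑ k ∈ Finset.range N, formalLaplace (1 - u)⁻¹ (laguerre ℂ k * laguerre ℂ k) := by
  rw [mean, integral_weight_mul_traceExp hN hu,
    inv_mul_cancel_left₀ (by exact_mod_cast (partitionFunction_pos hN).ne')]

end Ensemble

end Laguerre

theorem mainTheorem3 (N : ℕ) (hN : 1 ≤ N) (u : ℂ) (hu : u ≠ 0) (hu1 : u.re < 1) :
    -- the mean is well defined: finite positive normalisation, absolutely convergent integral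
    IntegrableOn (Laguerre.weight N) (Laguerre.orthant N) ∧
    0 < Laguerre.partitionFunction N ∧
    IntegrableOn
      (fun lam => (Laguerre.weight N lam : ℂ) * Laguerre.traceExp ((N : ℂ) * u) lam)
      (Laguerre.orthant N) ∧
    -- the two contour integral representations, for every admissible contour
    (∀ (a : ℂ) (γ : Path a a), Laguerre.IsContour u γ →
      Laguerre.mean N (Laguerre.traceExp ((N : ℂ) * u)) =
          1 / u * ((2 * Real.pi * Complex.I)⁻¹ * Laguerre.contourIntegral γ
            (fun z => (1 - z) ^ N / (1 - z - u) ^ N * ((z + u) ^ N / z ^ N))) ∧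
      Laguerre.mean N (Laguerre.traceExp ((N : ℂ) * u)) =
          1 / u * ((2 * Real.pi * Complex.I)⁻¹ * Laguerre.contourIntegral γ
            (fun z => (1 + 1 / (z + u - 1)) ^ N * (1 - 1 / z) ^ N))) ∧
    Laguerre.mean N (Laguerre.traceExp ((N : ℂ) * u)) = 1 / u * Laguerre.f N N u := by
  have hN0 : N ≠ 0 := Nat.one_le_iff_ne_zero.1 hN
  have hu1' : u ≠ 1 := fun h => by simp [h] at hu1
  have hcontour {a : ℂ} {γ : Path a a} (hγ : Laguerre.IsContour u γ) :
      Laguerre.mean N (Laguerre.traceExp ((N : ℂ) * u)) =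
        1 / u * ((2 * Real.pi * Complex.I)⁻¹ * Laguerre.contourIntegral γ
          (fun z => (1 + 1 / (z + u - 1)) ^ N * (1 - 1 / z) ^ N)) := by
    rw [Laguerre.mean_traceExp hN0 hu1, hγ.contourIntegral_eq_sum_formalLaplace hu1', one_div,
      inv_mul_cancel_left₀ hu]
  have hradius : 0 < ‖1 - u‖ := norm_pos_iff.2 (sub_ne_zero.2 hu1'.symm)
  have hcircle := hcontour
    (Laguerre.isContour_circlePath (half_pos hradius) (half_lt_self hradius))
  rw [Laguerre.contourIntegral_circlePath] at hcircle
  refine ⟨Laguerre.integrableOn_weight hN0, Laguerre.partitionFunction_pos hN0,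
    Laguerre.integrableOn_weight_mul_traceExp hN0 hu1, fun a γ hγ => ⟨?_, hcontour hγ⟩, hcircle⟩
  rw [hγ.contourIntegral_quotient_eq]
  exact hcontour hγ
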